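/- Let $(R,\mathfrak m)$ be a Noetherian local ring and $M$ a finitely generated $R$-module with $\dim M=d$. For an integer $i\ge 0$ let $$\operatorname{Psupp}^i_R(M)=\{\mathfrak p\in\operatorname{Spec}R \mid H^{\,i-\dim R/\mathfrak p}_{\mathfrak pR_{\mathfrak p}}(M_{\mathfrak p})\neq 0\}$$ be the $i$-th pseudo support of $M$ (local cohomology in negative degrees is zero), and let $$\operatorname{nCM}(M)=\{\mathfrak p\in\operatorname{Spec}R\mid M_{\mathfrak p}\text{ is not Cohen--Macaulay}\}$$ be the non-Cohen--Macaulay locus of $M$ (the zero module counts as Cohen--Macaulay, and has dimension $-\infty$). (i) Let $\mathfrak p\in\operatorname{Supp}_R(M)$. Then $\mathfrak p\in\operatorname{Psupp}^i_R(M)$ for some $i\le d$, and $$\operatorname{depth}(M_{\mathfrak p})=k-\dim(R/\mathfrak p),\qquad \dim(M_{\mathfrak p})=t-\dim(R/\mathfrak p),$$ where $k$ and $t$ are the least and the greatest integer $i\le d$ with $\mathfrak p\in\operatorname{Psupp}^i_R(M)$. (ii) $\displaystyle\operatorname{nCM}(M)=\bigcup_{0\le i<j\le d}\bigl(\operatorname{Psupp}^i_R(M)\cap\operatorname{Psupp}^j_R(M)\bigr).$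 (iii) For every integer $s$ (in particular for every $s\le d$), $$\bigcup_{0\le i\le s}\operatorname{Psupp}^i_R(M)=\{\mathfrak p\in\operatorname{Supp}_R(M)\mid \operatorname{depth}(M_{\mathfrak p})+\dim(R/\mathfrak p)\le s\}.$$ (iv) If $\mathfrak p\in\operatorname{Supp}_R(M)$ and $\mathfrak p\notin\operatorname{Psupp}^i_R(M)$ for all $0\le i<d$, then $M_{\mathfrak p}$ is Cohen--Macaulay of dimension $d-\dim(R/\mathfrak p)$. -/

import Mathlib

universe u

namespace PseudoSupport

open CategoryTheory IsLocalRing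

/-- The depth of a module `N` over a local ring `A`: the supremum of the lengths of the
`N`-regular sequences consisting of elements of the maximal ideal. (It is finite if `A` is
Noetherian and `N` is nonzero and finitely generated. The zero module has no regular sequence,
so it gets the value `0` here; its depth is never used below.) -/
noncomputable def depth (A : Type*) [CommRing A] [IsLocalRing A]
    (N : Type*) [AddCommGroup N] [Module A N] : ℕ∞ :=
  ⨆ (rs : List A) (_ : ∀ r ∈ rs, r ∈ maximalIdeal A)
    (_ : RingTheory.Sequence.IsRegular N rs), (rs.length : ℕ∞)

/-- A (finitely generated) module `N` over a (Noetherian) local ring `A` is Cohen-Macaulay if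
`N = 0` or `depth N = dim N`. -/
def IsCohenMacaulay (A : Type*) [CommRing A] [IsLocalRing A]
    (N : Type*) [AddCommGroup N] [Module A N] : Prop :=
  Subsingleton N ∨ (depth A N : WithBot ℕ∞) = Module.supportDim A N

variable (R : Type u) [CommRing R] (M : Type u) [AddCommGroup M] [Module R M]

/-- The localization `M_𝔭`, a module over `R_𝔭 = Localization.AtPrime 𝔭`. -/
abbrev Loc (p : PrimeSpectrum R) : Type u :=
  LocalizedModule p.asIdeal.primeCompl M

/-- The `i`-th pseudo support of `M`: the primes `𝔭` such that `H^{i - dim R/𝔭}_{𝔭 R_𝔭}(M_𝔭) ≠ 0`.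
The degree `j = i - dim R/𝔭` is encoded by `j + dim R/𝔭 = i` with `j` a natural number, because
local cohomology is zero in negative degrees. -/
def Psupp (i : ℕ) : Set (PrimeSpectrum R) :=
  {p | ∃ j : ℕ, (j : WithBot ℕ∞) + ringKrullDim (R ⧸ p.asIdeal) = i ∧
    ¬ Limits.IsZero
      ((localCohomology (maximalIdeal (Localization.AtPrime p.asIdeal)) j).obj
        (ModuleCat.of (Localization.AtPrime p.asIdeal) (Loc R M p)))}

/-- The non Cohen-Macaulay locus of `M`. -/
def nCM : Set (PrimeSpectrum R) :=
  {p | ¬ IsCohenMacaulay (Localization.AtPrime p.asIdeal) (Loc R M p)}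

end PseudoSupport

/-! Fix `p` in the support and put c = dim R/p. Over the Noetherian local ring R_p, the local
cohomology of the nonzero finitely generated module M_p vanishes below its depth and above its
dimension, and is nonzero in these two degrees. After the shift by c, the degrees i with `p` in the
i-th pseudo support lie between depth M_p + c and dim M_p + c, and both ends occur. Chains of primes
in the support of M that pass through `p` give dim M_p + c ≤ dim M. This is `exists_psupp_bounds`,
from which all four statements are read off.

The vanishing theorems come from the long exact sequence of a regular element x: each cohomology
class is killed by a power of x, so injectivity of x forces vanishing. The hard end is
`H.nontrivial_of_supportDim_eq`. If the top cohomology of N, in degree n + 1, vanished, pass to N' =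
N modulo torsion. As H^n(N') is Artinian, a secondary decomposition yields a regular x with
H^n(N')/x finitely generated, hence so is H^n(N'/xN'), the top cohomology of a module of dimension
n. By induction it is nonzero; but for n > 0 a finitely generated top cohomology is zero by
Nakayama, while for n = 0 it embeds in H^1(N') = 0.

Only vanishing matters, so `localCohomology` is replaced by a direct limit of derived-category Ext
groups, whose long exact sequences pass to the limit. -/

section

universe v w
open CategoryTheory Limits Opposite

/-! ### Comparison of the two Ext groups through cocycles on a projective resolution -/

namespace CategoryTheory.ProjectiveResolution

section

variable {R : Type*} [Ring R] {C : Type*} [Category* C] [Abelian C] [Linear R C]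
  [EnoughProjectives C] {X X' Y : C}

/-- The complex `Hom(P, Y)`, as a chain complex in the opposite category of modules. -/
noncomputable abbrev yonedaOp (R : Type*) [Ring R] [Linear R C] (P : ProjectiveResolution X)
    (Y : C) : ChainComplex (ModuleCat R)ᵒᵖ ℕ :=
  (((linearYoneda R C).obj Y).rightOp.mapHomologicalComplex _).obj P.complex

/-- The class `x` in the derived functor `Ext` is represented by the cochain `f` on `P`. -/
def Represents (P : ProjectiveResolution X) {n : ℕ} (f : P.complex.X n ⟶ Y)
    (x : ((Ext R C n).obj (op X)).obj Y) : Prop :=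
  ∃ z : ((P.yonedaOp R Y).opcycles n).unop,
    ((P.yonedaOp R Y).pOpcycles n).unop.hom z = f ∧
    (P.isoLeftDerivedObj ((linearYoneda R C).obj Y).rightOp n).hom.unop.hom
      (((P.yonedaOp R Y).homologyι n).unop.hom z) = x

lemma exists_represents (P : ProjectiveResolution X) {n : ℕ}
    (x : ((Ext R C n).obj (op X)).obj Y) :
    ∃ f : P.complex.X n ⟶ Y, P.complex.d (n + 1) n ≫ f = 0 ∧ P.Represents f x := by
  have h1 : Function.Surjective
      (P.isoLeftDerivedObj ((linearYoneda R C).obj Y).rightOp n).hom.unop.hom :=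
    (ModuleCat.epi_iff_surjective _).1 inferInstance
  have h2 : Function.Surjective ((P.yonedaOp R Y).homologyι n).unop.hom :=
    (ModuleCat.epi_iff_surjective _).1 inferInstance
  obtain ⟨y, rfl⟩ := h1 x
  obtain ⟨z, rfl⟩ := h2 y
  refine ⟨((P.yonedaOp R Y).pOpcycles n).unop.hom z, ?_, z, rfl, rfl⟩
  have h3 := (P.yonedaOp R Y).d_pOpcycles (n + 1) n
  exact congr($(congrArg Quiver.Hom.unop h3).hom z)

lemma exists_of_cocycle (P : ProjectiveResolution X) {n : ℕ} (f : P.complex.X n ⟶ Y)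
    (hf : P.complex.d (n + 1) n ≫ f = 0) :
    ∃ x : ((Ext R C n).obj (op X)).obj Y, P.Represents f x := by
  have h := (ShortComplex.exact_of_g_is_cokernel
    (ShortComplex.mk _ _ ((P.yonedaOp R Y).d_pOpcycles (n + 1) n))
    ((P.yonedaOp R Y).opcyclesIsCokernel (n + 1) n (by simp))).unop
  rw [ShortComplex.moduleCat_exact_iff] at h
  obtain ⟨z, hz⟩ := h f hf
  exact ⟨_, z, hz, rfl⟩

/-- Homology is the kernel of `fromOpcycles`; undoing the opposite turns it into cocycles modulo
coboundaries. In degree 0, `next 0 = 0` and the differential is zero, so the condition becomes f =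
0. -/
lemma Represents.eq_zero_iff {P : ProjectiveResolution X} {n : ℕ} {f : P.complex.X n ⟶ Y}
    {x : ((Ext R C n).obj (op X)).obj Y} (h : P.Represents f x) :
    x = 0 ↔ ∃ g, P.complex.d n ((ComplexShape.down ℕ).next n) ≫ g = f := by
  obtain ⟨z, rfl, rfl⟩ := h
  have h1 : Function.Injective
      (P.isoLeftDerivedObj ((linearYoneda R C).obj Y).rightOp n).hom.unop.hom :=
    (ModuleCat.mono_iff_injective _).1 inferInstance
  have h2 : Function.Injective ((P.yonedaOp R Y).pOpcycles n).unop.hom :=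
    (ModuleCat.mono_iff_injective _).1 inferInstance
  have h3 := (ShortComplex.exact_of_f_is_kernel
    (ShortComplex.mk _ _ ((P.yonedaOp R Y).homologyι_comp_fromOpcycles n _))
    ((P.yonedaOp R Y).homologyIsKernel n _ rfl)).unop
  have h4 := congrArg Quiver.Hom.unop
    ((P.yonedaOp R Y).p_fromOpcycles n ((ComplexShape.down ℕ).next n))
  have h5 := congrArg Quiver.Hom.unop
    ((P.yonedaOp R Y).homologyι_comp_fromOpcycles n ((ComplexShape.down ℕ).next n))
  refine (map_eq_zero_iff _ h1).trans ?_
  constructor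
  · intro h0
    rw [ShortComplex.moduleCat_exact_iff] at h3
    obtain ⟨g, hg⟩ := h3 z h0
    refine ⟨g, ?_⟩
    rw [← hg]
    exact congr($(h4).hom g).symm
  · rintro ⟨g, hg⟩
    have h6 : ((P.yonedaOp R Y).fromOpcycles n ((ComplexShape.down ℕ).next n)).unop.hom g = z := by
      apply h2
      rw [← hg]
      exact congr($(h4).hom g)
    rw [← h6]
    exact congr($(h5).hom g)

lemma Represents.precomp {P : ProjectiveResolution X} {P' : ProjectiveResolution X'} {n : ℕ}
    {f : P.complex.X n ⟶ Y}
    {x : ((Ext R C n).obj (op X)).obj Y} (h : P.Represents f x) {g : X' ⟶ X}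
    (φ : Hom P' P g) :
    P'.Represents (φ.hom.f n ≫ f) ((((Ext R C n).map g.op).app Y).hom x) := by
  obtain ⟨z, rfl, rfl⟩ := h
  let ψ := (((linearYoneda R C).obj Y).rightOp.mapHomologicalComplex
    (ComplexShape.down ℕ)).map φ.hom
  have h1 := congrArg Quiver.Hom.unop (isoLeftDerivedObj_hom_naturality g P' P φ.hom
    (by simpa using φ.hom_f_zero_comp_π_f_zero) ((linearYoneda R C).obj Y).rightOp n)
  have h2 := congrArg Quiver.Hom.unop (HomologicalComplex.homologyι_naturality ψ n)
  have h3 := congrArg Quiver.Hom.unop (HomologicalComplex.p_opcyclesMap ψ n)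
  refine ⟨(HomologicalComplex.opcyclesMap ψ n).unop.hom z, congr($(h3).hom z), ?_⟩
  refine Eq.trans ?_ congr($(h1).hom (((P.yonedaOp R Y).homologyι n).unop.hom z)).symm
  exact congr((P'.isoLeftDerivedObj ((linearYoneda R C).obj Y).rightOp n).hom.unop.hom
    ($(h2).hom z)).symm

end

section

variable {C : Type*} [Category* C] [Abelian C] [HasExt.{w} C] {X Y : C}

open CochainComplex.HomComplex CochainComplex in
lemma extMk_eq_zero_iff' (P : ProjectiveResolution X) {n : ℕ} (f : P.complex.X n ⟶ Y)
    (hf : P.complex.d (n + 1) n ≫ f = 0) :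
    P.extMk f (n + 1) rfl hf = 0 ↔
      ∃ g, P.complex.d n ((ComplexShape.down ℕ).next n) ≫ g = f := by
  cases n with
  | succ n =>
    have : (ComplexShape.down ℕ).next (n + 1) = n := by simp
    rw [this]
    exact P.extMk_eq_zero_iff f _ rfl hf n rfl
  | zero =>
    have h0 : P.complex.d 0 ((ComplexShape.down ℕ).next 0) = 0 := P.complex.shape _ _ (by simp)
    simp only [h0, zero_comp, ← P.extEquivCohomologyClass.apply_eq_iff_eq,
      extEquivCohomologyClass_extMk, extEquivCohomologyClass_zero,
      CohomologyClass.mk_eq_zero_iff]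
    rw [Cocycle.toSingleMk_mem_coboundaries_iff _ _ _ _ _ 1 (by simp)]
    -- The resolution lives in nonpositive cohomological degrees, so degree 0 has no nonzero
    -- coboundaries.
    have h1 : IsZero (P.cochainComplex.X 1) := isZero_of_isStrictlyLE _ 0 1 (by lia)
    constructor
    · rintro ⟨g, hg⟩
      rw [h1.eq_of_src g 0, comp_zero] at hg
      exact ⟨0, ((cancel_epi (P.cochainComplexXIso _ 0 rfl).hom).1
        (comp_zero.trans hg))⟩
    · rintro ⟨-, rfl⟩
      exact ⟨0, by simp⟩

end

end CategoryTheory.ProjectiveResolution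

end

/-! ### Local cohomology as a direct limit of derived-category Ext groups -/

section

open CategoryTheory Limits Opposite Abelian

namespace PseudoSupport

variable {A : Type u} [CommRing A] (J : Ideal A)

/-- The projection `A ⧸ J ^ s ⟶ A ⧸ J ^ t` for `t ≤ s`. -/
def powQuotMap {t s : ℕ} (h : t ≤ s) :
    ModuleCat.of A (A ⧸ J ^ s) ⟶ ModuleCat.of A (A ⧸ J ^ t) :=
  ModuleCat.ofHom (Submodule.mapQ _ _ LinearMap.id (Ideal.pow_le_pow_right h))

lemma powQuotMap_comp {t s r : ℕ} (h : t ≤ s) (h' : s ≤ r) :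
    powQuotMap J h' ≫ powQuotMap J h = powQuotMap J (h.trans h') := by
  ext; rfl

lemma powQuotMap_self {t : ℕ} : powQuotMap J le_rfl = 𝟙 (ModuleCat.of A (A ⧸ J ^ t)) := by
  ext; rfl

/-- The transition maps of the directed system computing local cohomology. -/
noncomputable def extTransition (i : ℕ) (N : ModuleCat.{u} A) (t s : ℕ) (h : t ≤ s) :
    Abelian.Ext (ModuleCat.of A (A ⧸ J ^ t)) N i →ₗ[A]
      Abelian.Ext (ModuleCat.of A (A ⧸ J ^ s)) N i :=
  (Abelian.Ext.mk₀ (powQuotMap J h)).precompOfLinear A N (zero_add i)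

lemma extTransition_apply (i : ℕ) (N : ModuleCat.{u} A) {t s : ℕ} (h : t ≤ s)
    (e : Abelian.Ext (ModuleCat.of A (A ⧸ J ^ t)) N i) :
    extTransition J i N t s h e = (Abelian.Ext.mk₀ (powQuotMap J h)).comp e (zero_add i) := rfl

instance (i : ℕ) (N : ModuleCat.{u} A) :
    DirectedSystem (fun t : ℕ ↦ Abelian.Ext (ModuleCat.of A (A ⧸ J ^ t)) N i)
      (extTransition J i N · · ·) where
  map_self t e := by
    rw [extTransition_apply, powQuotMap_self, Abelian.Ext.mk₀_id_comp]
  map_map t s r h h' e := by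
    simp only [extTransition_apply]
    rw [Abelian.Ext.mk₀_comp_mk₀_assoc, powQuotMap_comp]

/-- Local cohomology as the direct limit of the modules `Ext (A ⧸ J ^ t) N i`, where `Ext` is
defined by means of the derived category. -/
abbrev LocCoh (i : ℕ) (N : ModuleCat.{u} A) : Type u :=
  Module.DirectLimit (fun t : ℕ ↦ Abelian.Ext (ModuleCat.of A (A ⧸ J ^ t)) N i)
    (extTransition J i N)

lemma subsingleton_locCoh_iff (i : ℕ) (N : ModuleCat.{u} A) :
    Subsingleton (LocCoh J i N) ↔
      ∀ (t : ℕ) (e : Abelian.Ext (ModuleCat.of A (A ⧸ J ^ t)) N i), ∃ (s : ℕ) (h : t ≤ s),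
        extTransition J i N t s h e = 0 := by
  constructor
  · intro _ t e
    exact Module.DirectLimit.of.zero_exact (Subsingleton.elim
      (Module.DirectLimit.of A ℕ _ (extTransition J i N) t e) 0)
  · intro H
    refine subsingleton_of_forall_eq 0 fun x ↦ ?_
    obtain ⟨t, e, rfl⟩ := Module.DirectLimit.exists_of x
    obtain ⟨s, h, hs⟩ := H t e
    rw [← Module.DirectLimit.of_f (hij := h), hs, map_zero]

/-- Colimits of functors are computed pointwise, and in a filtered colimit of modules an element is
zero exactly when it dies at a finite stage. -/
lemma isZero_localCohomology_obj_iff (i : ℕ) (N : ModuleCat.{u} A) :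
    IsZero ((localCohomology J i).obj N) ↔
      ∀ (t : ℕ) (x : ((Ext A (ModuleCat.{u} A) i).obj (op (ModuleCat.of A (A ⧸ J ^ t)))).obj N),
        ∃ (s : ℕ) (h : t ≤ s),
          (((Ext A (ModuleCat.{u} A) i).map (powQuotMap J h).op).app N).hom x = 0 := by
  let F := localCohomology.diagram (localCohomology.idealPowersDiagram J) i
  have e : (localCohomology J i).obj N ≅ colimit (F ⋙ (evaluation _ _).obj N) :=
    colimitObjIsoColimitCompEvaluation F N
  have := preservesSmallestFilteredColimits_of_preservesFilteredColimits
    (forget (ModuleCat.{u} A))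
  rw [e.isZero_iff, ModuleCat.isZero_iff_subsingleton]
  constructor
  · intro _ t x
    obtain ⟨s, f, hs⟩ := Concrete.colimit_rep_eq_zero A (F ⋙ (evaluation _ _).obj N) (op (op t)) x
      (Subsingleton.elim _ _)
    exact ⟨s.unop.unop, f.unop.unop.down.down, hs⟩
  · intro H
    refine subsingleton_of_forall_eq 0 fun x ↦ ?_
    obtain ⟨t, y, rfl⟩ := Concrete.colimit_exists_rep _ x
    obtain ⟨s, h, hs⟩ := H t.unop.unop y
    have h1 := colimit.w (F ⋙ (evaluation _ _).obj N) 
      ((homOfLE h).op.op : t ⟶ op (op s))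
    have h2 := congr($(h1).hom y)
    refine h2.symm.trans ?_
    refine Eq.trans ?_ (map_zero (colimit.ι (F ⋙ (evaluation _ _).obj N) (op (op s))).hom)
    exact congrArg _ hs

/-- Both sides say that every class dies at a finite stage. Classes of either kind are given by the
same cocycles on a resolution of A/J^t, have the same vanishing criterion, and pull back along the
same lift φ. -/
lemma isZero_localCohomology_obj_iff_subsingleton (i : ℕ) (N : ModuleCat.{u} A) :
    IsZero ((localCohomology J i).obj N) ↔ Subsingleton (LocCoh J i N) := by
  rw [isZero_localCohomology_obj_iff, subsingleton_locCoh_iff]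
  let P (t : ℕ) := projectiveResolution (ModuleCat.of A (A ⧸ J ^ t))
  let φ {t s : ℕ} (h : t ≤ s) : ProjectiveResolution.Hom (P s) (P t) (powQuotMap J h) :=
    ⟨ProjectiveResolution.lift (powQuotMap J h) _ _, by
      simpa using ProjectiveResolution.lift_commutes_zero (powQuotMap J h) _ _⟩
  refine forall_congr' fun t ↦ ⟨fun H e ↦ ?_, fun H x ↦ ?_⟩
  · obtain ⟨f, hf, rfl⟩ := (P t).extMk_surjective e (i + 1) rfl
    obtain ⟨x, hx⟩ := (P t).exists_of_cocycle (R := A) f hf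
    obtain ⟨s, h, hs⟩ := H x
    refine ⟨s, h, ?_⟩
    rw [extTransition_apply, ProjectiveResolution.mk₀_comp_extMk f _ rfl hf (φ h),
      ProjectiveResolution.extMk_eq_zero_iff', ← (hx.precomp (φ h)).eq_zero_iff]
    exact hs
  · obtain ⟨f, hf, hx⟩ := (P t).exists_represents x
    obtain ⟨s, h, hs⟩ := H ((P t).extMk f (i + 1) rfl hf)
    refine ⟨s, h, (hx.precomp (φ h)).eq_zero_iff.2 ?_⟩
    rw [extTransition_apply, ProjectiveResolution.mk₀_comp_extMk f _ rfl hf (φ h),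
      ProjectiveResolution.extMk_eq_zero_iff'] at hs
    exact hs

end PseudoSupport

end

/-! ### Long exact sequence, torsion and degree zero -/

section

open CategoryTheory Limits Opposite Abelian

namespace PseudoSupport
namespace LocCoh

variable {A : Type u} [CommRing A] (J : Ideal A)

/-- The class in local cohomology of an element of `Ext (A ⧸ J ^ t) N i`. -/
noncomputable abbrev of (i : ℕ) (N : ModuleCat.{u} A) (t : ℕ) :
    Abelian.Ext (ModuleCat.of A (A ⧸ J ^ t)) N i →ₗ[A] LocCoh J i N :=
  Module.DirectLimit.of A ℕ _ (extTransition J i N) t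

/-- The map on local cohomology induced by an extension class. -/
noncomputable def postcomp {N N' : ModuleCat.{u} A} {a i b : ℕ} (β : Abelian.Ext N N' a)
    (h : i + a = b) : LocCoh J i N →ₗ[A] LocCoh J b N' :=
  Module.DirectLimit.map (fun _ ↦ β.postcompOfLinear A _ h) (by
    intro t s hts
    ext e
    exact Abelian.Ext.comp_assoc _ _ _ (zero_add _) h (by lia))

lemma postcomp_of {N N' : ModuleCat.{u} A} {a i b : ℕ} (β : Abelian.Ext N N' a)
    (h : i + a = b) (t : ℕ) (e : Abelian.Ext (ModuleCat.of A (A ⧸ J ^ t)) N i) :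
    postcomp J β h (of J i N t e) = of J b N' t (e.comp β h) :=
  Module.DirectLimit.map_apply_of _ _ _

lemma extTransition_comp {N N' : ModuleCat.{u} A} {a i b : ℕ} (β : Abelian.Ext N N' a)
    (h : i + a = b) {t s : ℕ} (hts : t ≤ s) (e : Abelian.Ext (ModuleCat.of A (A ⧸ J ^ t)) N i) :
    extTransition J b N' t s hts (e.comp β h) = (extTransition J i N t s hts e).comp β h :=
  (Abelian.Ext.comp_assoc _ _ _ (zero_add _) h (by lia)).symm

/-- A class killed in the limit is killed at a finite stage, where exactness of the Ext sequence
supplies a preimage. The three exactness statements of the long exact sequence are instances. -/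
lemma exact_postcomp {N₁ N₂ N₃ : ModuleCat.{u} A} {a b i j k : ℕ} (β : Abelian.Ext N₁ N₂ a)
    (γ : Abelian.Ext N₂ N₃ b) (h : i + a = j) (h' : j + b = k)
    (H : ∀ (X : ModuleCat.{u} A) (e : Abelian.Ext X N₂ j), e.comp γ h' = 0 →
      ∃ e' : Abelian.Ext X N₁ i, e'.comp β h = e)
    (H' : β.comp γ rfl = 0) :
    Function.Exact (postcomp J β h) (postcomp J γ h') := by
  intro x
  constructor
  · intro hx
    obtain ⟨t, e, rfl⟩ := Module.DirectLimit.exists_of x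
    rw [postcomp_of] at hx
    obtain ⟨s, hts, hs⟩ := Module.DirectLimit.of.zero_exact hx
    rw [extTransition_comp] at hs
    obtain ⟨e', he'⟩ := H _ _ hs
    refine ⟨of J i N₁ s e', ?_⟩
    rw [postcomp_of, he', Module.DirectLimit.of_f]
  · rintro ⟨y, rfl⟩
    obtain ⟨t, e, rfl⟩ := Module.DirectLimit.exists_of y
    rw [postcomp_of, postcomp_of, Abelian.Ext.comp_assoc _ _ _ _ rfl (by lia), H',
      Abelian.Ext.comp_zero, map_zero]

/-- Functoriality of local cohomology. -/
noncomputable def map (i : ℕ) {N N' : ModuleCat.{u} A} (f : N ⟶ N') :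
    LocCoh J i N →ₗ[A] LocCoh J i N' :=
  postcomp J (Abelian.Ext.mk₀ f) (add_zero i)

/-- The connecting homomorphism of local cohomology. -/
noncomputable def δ (i : ℕ) {N₁ N₂ N₃ : ModuleCat.{u} A} {f : N₁ ⟶ N₂} {g : N₂ ⟶ N₃}
    {w : f ≫ g = 0} (hS : (ShortComplex.mk f g w).ShortExact) :
    LocCoh J i N₃ →ₗ[A] LocCoh J (i + 1) N₁ :=
  postcomp J hS.extClass rfl

section

variable {N₁ N₂ N₃ : ModuleCat.{u} A} {f : N₁ ⟶ N₂} {g : N₂ ⟶ N₃} {w : f ≫ g = 0}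
  (hS : (ShortComplex.mk f g w).ShortExact) (i : ℕ)
include hS

lemma exact_map_map : Function.Exact (map J i f) (map J i g) :=
  exact_postcomp J _ _ _ _ (fun X e he ↦ Abelian.Ext.covariant_sequence_exact₂ X hS e he)
    (by rw [Abelian.Ext.mk₀_comp_mk₀, w, Abelian.Ext.mk₀_zero])

lemma exact_map_δ : Function.Exact (map J i g) (δ J i hS) :=
  exact_postcomp J _ _ _ _ (fun X e he ↦ Abelian.Ext.covariant_sequence_exact₃ X hS e rfl he)
    hS.comp_extClass

lemma exact_δ_map : Function.Exact (δ J i hS) (map J (i + 1) f) :=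
  exact_postcomp J _ _ _ _ (fun X e he ↦ Abelian.Ext.covariant_sequence_exact₁ X hS e he rfl)
    hS.extClass_comp

end

lemma map_smul_id (i : ℕ) (N : ModuleCat.{u} A) (r : A) (x : LocCoh J i N) :
    map J i (r • 𝟙 N) x = r • x := by
  obtain ⟨t, e, rfl⟩ := Module.DirectLimit.exists_of x
  rw [map, postcomp_of, ← Abelian.Ext.smul_eq_comp_mk₀, map_smul]

lemma exists_pow_smul_eq_zero (i : ℕ) (N : ModuleCat.{u} A) (x : LocCoh J i N) :
    ∃ t : ℕ, ∀ r ∈ J ^ t, r • x = 0 := by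
  obtain ⟨t, e, rfl⟩ := Module.DirectLimit.exists_of x
  refine ⟨t, fun r hr ↦ ?_⟩
  have h : r • 𝟙 (ModuleCat.of A (A ⧸ J ^ t)) = 0 := by
    ext
    simpa [Algebra.smul_def] using Ideal.Quotient.eq_zero_iff_mem.2 hr
  rw [← map_smul, ← Abelian.Ext.mk₀_id_comp e, ← Abelian.Ext.smul_comp, ← Abelian.Ext.mk₀_smul, h,
    Abelian.Ext.mk₀_zero, Abelian.Ext.zero_comp, map_zero]

instance (i : ℕ) (N : ModuleCat.{u} A) [Injective N] : Subsingleton (LocCoh J (i + 1) N) := by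
  rw [subsingleton_locCoh_iff]
  exact fun t e ↦ ⟨t, le_rfl, by rw [Abelian.Ext.eq_zero_of_injective e, map_zero]⟩

lemma linearEquiv₀_mk₀ {X N : ModuleCat.{u} A} (f : X ⟶ N) :
    Abelian.Ext.linearEquiv₀ (R := A) (Abelian.Ext.mk₀ f) = f :=
  Abelian.Ext.linearEquiv₀.apply_symm_apply f

/-- Local cohomology in degree zero embeds into the module. -/
noncomputable def ι (N : ModuleCat.{u} A) : LocCoh J 0 N →ₗ[A] N :=
  Module.DirectLimit.lift A ℕ _ _ (fun t ↦
    { toFun e := (Abelian.Ext.linearEquiv₀ (R := A) e).hom (Ideal.Quotient.mk _ 1)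
      map_add' := by simp
      map_smul' := by simp }) (by
    intro t s h e
    obtain ⟨f, rfl⟩ := Abelian.Ext.linearEquiv₀ (R := A).symm.surjective e
    rw [extTransition_apply]
    simp only [Abelian.Ext.linearEquiv₀_symm_apply, Abelian.Ext.mk₀_comp_mk₀, LinearMap.coe_mk,
      AddHom.coe_mk, linearEquiv₀_mk₀]
    rfl)

lemma ι_of (N : ModuleCat.{u} A) (t : ℕ) (f : ModuleCat.of A (A ⧸ J ^ t) ⟶ N) :
    ι J N (of J 0 N t (Abelian.Ext.mk₀ f)) = f.hom (Ideal.Quotient.mk _ 1) := by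
  rw [ι, Module.DirectLimit.lift_of]
  simp only [LinearMap.coe_mk, AddHom.coe_mk, linearEquiv₀_mk₀]

lemma exists_of_mk₀ {N : ModuleCat.{u} A} (x : LocCoh J 0 N) :
    ∃ (t : ℕ) (f : ModuleCat.of A (A ⧸ J ^ t) ⟶ N), of J 0 N t (Abelian.Ext.mk₀ f) = x := by
  obtain ⟨t, e, rfl⟩ := Module.DirectLimit.exists_of x
  obtain ⟨f, rfl⟩ := (Abelian.Ext.linearEquiv₀ (R := A)).symm.surjective e
  exact ⟨t, f, rfl⟩

lemma ι_injective (N : ModuleCat.{u} A) : Function.Injective (ι J N) := by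
  rw [injective_iff_map_eq_zero]
  intro x hx
  obtain ⟨t, f, rfl⟩ := exists_of_mk₀ J x
  rw [ι_of] at hx
  have : f = 0 := by
    ext
    simpa using hx
  rw [this, Abelian.Ext.mk₀_zero, map_zero]

lemma mem_range_ι (N : ModuleCat.{u} A) (x : N) :
    x ∈ LinearMap.range (ι J N) ↔ ∃ t : ℕ, ∀ r ∈ J ^ t, r • x = 0 := by
  constructor
  · rintro ⟨y, rfl⟩
    obtain ⟨t, ht⟩ := exists_pow_smul_eq_zero J 0 N y
    exact ⟨t, fun r hr ↦ by rw [← map_smul, ht r hr, map_zero]⟩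
  · rintro ⟨t, ht⟩
    let f : A ⧸ J ^ t →ₗ[A] N := Submodule.liftQ _ (LinearMap.toSpanSingleton A N x)
      fun r hr ↦ ht r hr
    refine ⟨of J 0 N t (Abelian.Ext.mk₀ (ModuleCat.ofHom f)), ?_⟩
    rw [ι_of]
    exact (Submodule.liftQ_apply ..).trans (one_smul A x)

lemma ι_map {N N' : ModuleCat.{u} A} (f : N ⟶ N') (x : LocCoh J 0 N) :
    ι J N' (map J 0 f x) = f.hom (ι J N x) := by
  obtain ⟨t, g, rfl⟩ := exists_of_mk₀ J x
  rw [map, postcomp_of, Abelian.Ext.mk₀_comp_mk₀, ι_of, ι_of]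
  rfl

end LocCoh
end PseudoSupport

end

/-! ### Power-torsion modules and their vanishing in positive degrees -/

section

open CategoryTheory Limits Opposite Abelian

namespace PseudoSupport

section Torsion

variable {A : Type*} [CommRing A] (J : Ideal A)

/-- A module is `J`-torsion if each of its elements is annihilated by a power of `J`. -/
def IsPowTorsion (N : Type*) [AddCommGroup N] [Module A N] : Prop :=
  ∀ x : N, ∃ t : ℕ, ∀ r ∈ J ^ t, r • x = 0

/-- The largest `J`-torsion submodule. -/
def powTorsion (N : Type*) [AddCommGroup N] [Module A N] : Submodule A N where
  carrier := {x | ∃ t : ℕ, ∀ r ∈ J ^ t, r • x = 0}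
  zero_mem' := ⟨0, by simp⟩
  add_mem' := by
    rintro x y ⟨t, ht⟩ ⟨s, hs⟩
    refine ⟨t + s, fun r hr ↦ ?_⟩
    rw [smul_add, ht r (Ideal.pow_le_pow_right (by lia) hr),
      hs r (Ideal.pow_le_pow_right (by lia) hr), add_zero]
  smul_mem' := by
    rintro a x ⟨t, ht⟩
    exact ⟨t, fun r hr ↦ by rw [smul_comm, ht r hr, smul_zero]⟩

variable {J} {N N' : Type*} [AddCommGroup N] [Module A N] [AddCommGroup N'] [Module A N']

lemma isPowTorsion_powTorsion : IsPowTorsion J (powTorsion J N) :=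
  fun ⟨_, t, ht⟩ ↦ ⟨t, fun r hr ↦ Subtype.ext (ht r hr)⟩

lemma IsPowTorsion.of_injective (h : IsPowTorsion J N') (f : N →ₗ[A] N')
    (hf : Function.Injective f) : IsPowTorsion J N := fun x ↦ by
  obtain ⟨t, ht⟩ := h (f x)
  exact ⟨t, fun r hr ↦ hf (by rw [map_smul, ht r hr, map_zero])⟩

lemma IsPowTorsion.of_surjective (h : IsPowTorsion J N) (f : N →ₗ[A] N')
    (hf : Function.Surjective f) : IsPowTorsion J N' := fun y ↦ by
  obtain ⟨x, rfl⟩ := hf y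
  obtain ⟨t, ht⟩ := h x
  exact ⟨t, fun r hr ↦ by rw [← map_smul, ht r hr, map_zero]⟩

lemma IsPowTorsion.exists_pow [Module.Finite A N] (h : IsPowTorsion J N) :
    ∃ t : ℕ, ∀ r ∈ J ^ t, ∀ x : N, r • x = 0 := by
  obtain ⟨s, hs⟩ := (Module.Finite.fg_top : (⊤ : Submodule A N).FG)
  choose t ht using h
  refine ⟨s.sup t, fun r hr x ↦ ?_⟩
  have hx : x ∈ Submodule.span A (s : Set N) := hs ▸ Submodule.mem_top
  induction hx using Submodule.span_induction with
  | mem y hy => exact ht y r (Ideal.pow_le_pow_right (Finset.le_sup hy) hr)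
  | zero => exact smul_zero r
  | add y z _ _ hy hz => rw [smul_add, hy, hz, add_zero]
  | smul a y _ hy => rw [smul_comm, hy, smul_zero]

lemma powTorsion_quotient_eq_bot [IsNoetherianRing A] [Module.Finite A N] :
    powTorsion J (N ⧸ powTorsion J N) = ⊥ := by
  rw [eq_bot_iff]
  intro y hy
  obtain ⟨x, rfl⟩ := Submodule.mkQ_surjective _ y
  obtain ⟨t, ht⟩ := hy
  obtain ⟨s, hs⟩ := (isPowTorsion_powTorsion (J := J) (N := N)).exists_pow
  have hx : x ∈ powTorsion J N := by
    refine ⟨s + t, fun r hr ↦ ?_⟩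
    rw [pow_add] at hr
    induction hr using Submodule.mul_induction_on' with
    | mem_mul_mem a ha b hb =>
      have hb' : b • x ∈ powTorsion J N := by
        rw [← Submodule.Quotient.mk_eq_zero]
        exact ht b hb
      rw [mul_smul]
      exact congrArg Subtype.val (hs a ha ⟨_, hb'⟩)
    | add a _ b _ ha hb => rw [add_smul, ha, hb, add_zero]
  simpa using hx

end Torsion

section

variable {A : Type u} [CommRing A] {J : Ideal A}

/-- Baer's criterion with Artin–Rees: the image of g is killed by some J^c, so g vanishes on I ∩
J^(k+c) and factors through a submodule of A/J^(k+c). Extend to E; the image of 1 is then torsion.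
-/
lemma injective_powTorsion [IsNoetherianRing A] (E : Type u) [AddCommGroup E] [Module A E]
    [hE : Module.Injective A E] : Module.Injective A (powTorsion J E) := by
  refine Module.Baer.injective fun I g ↦ ?_
  obtain ⟨c, hc⟩ := (isPowTorsion_powTorsion.of_injective g.range.subtype
    g.range.injective_subtype : IsPowTorsion J (LinearMap.range g)).exists_pow
  obtain ⟨k, hk⟩ := J.exists_pow_inf_eq_pow_smul (M := A) I
  let K : Submodule A I := Submodule.comap (Submodule.subtype I) (J ^ (k + c))
  have hK : ∀ x ∈ K, g x = 0 := by
    intro x hx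
    have h1 : (x : A) ∈ J ^ c • (J ^ k • ⊤ ⊓ I : Submodule A A) := by
      have h2 := hk (k + c) (by lia)
      rw [Nat.add_sub_cancel_left] at h2
      rw [← h2]
      exact ⟨by simpa using! hx, x.2⟩
    have h3 : ∀ y ∈ J ^ c • (J ^ k • ⊤ ⊓ I : Submodule A A), ∃ h : y ∈ I, g ⟨y, h⟩ = 0 := by
      intro y hy
      induction hy using Submodule.smul_induction_on' with
      | smul r hr z hz =>
        refine ⟨I.smul_mem r hz.2, ?_⟩
        have := congrArg Subtype.val (hc r hr ⟨g ⟨z, hz.2⟩, _, rfl⟩)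
        exact (map_smul g r ⟨z, hz.2⟩).trans this
      | add y _ z _ hy hz =>
        obtain ⟨h, h'⟩ := hy
        obtain ⟨k, k'⟩ := hz
        exact ⟨I.add_mem h k, (map_add g ⟨y, h⟩ ⟨z, k⟩).trans (by rw [h', k', add_zero])⟩
    exact (h3 x h1).2
  let i : (I ⧸ K) →ₗ[A] A ⧸ J ^ (k + c) := Submodule.mapQ _ _ (Submodule.subtype I) le_rfl
  have hi : Function.Injective i := by
    rw [injective_iff_map_eq_zero]
    intro x hx
    obtain ⟨x, rfl⟩ := Submodule.mkQ_surjective _ x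
    exact (Submodule.Quotient.mk_eq_zero K).2
      ((Submodule.Quotient.mk_eq_zero (J ^ (k + c)) (x := (x : A))).1 hx)
  let g' : (I ⧸ K) →ₗ[A] E := K.liftQ ((powTorsion J E).subtype ∘ₗ g)
    fun x hx ↦ by simp [hK x hx]
  obtain ⟨h, hh⟩ := hE.out i hi g'
  let e : E := h (Submodule.Quotient.mk 1)
  have he : e ∈ powTorsion J E := by
    refine ⟨k + c, fun r hr ↦ ?_⟩
    rw [← map_smul, ← Submodule.Quotient.mk_smul, (Submodule.Quotient.mk_eq_zero _).2, map_zero]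
    simpa using hr
  refine ⟨LinearMap.toSpanSingleton A _ ⟨e, he⟩, fun x hx ↦ Subtype.ext ?_⟩
  refine Eq.trans ?_ (hh (Submodule.Quotient.mk ⟨x, hx⟩))
  change x • e = h (Submodule.Quotient.mk x)
  rw [← map_smul, ← Submodule.Quotient.mk_smul, smul_eq_mul, mul_one]

variable (J) in
/-- Local cohomology of an unbundled module. -/
abbrev H (i : ℕ) (N : Type u) [AddCommGroup N] [Module A N] : Type u :=
  LocCoh J i (ModuleCat.of A N)

namespace H

variable {N₁ N₂ N₃ N : Type u} [AddCommGroup N₁] [Module A N₁] [AddCommGroup N₂] [Module A N₂]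
  [AddCommGroup N₃] [Module A N₃] [AddCommGroup N] [Module A N]

variable (J) in
/-- The map on local cohomology induced by a linear map. -/
noncomputable def map (i : ℕ) (f : N₁ →ₗ[A] N₂) : H J i N₁ →ₗ[A] H J i N₂ :=
  LocCoh.map J i (ModuleCat.ofHom f)

lemma shortExact {f : N₁ →ₗ[A] N₂} {g : N₂ →ₗ[A] N₃} (hf : Function.Injective f)
    (hg : Function.Surjective g) (hfg : Function.Exact f g) :
    (ShortComplex.mk (ModuleCat.ofHom f) (ModuleCat.ofHom g) (by
      rw [← ModuleCat.ofHom_comp, hfg.linearMap_comp_eq_zero]; rfl)).ShortExact where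
  exact := ModuleCat.shortComplex_exact _ hfg
  mono_f := (ModuleCat.mono_iff_injective _).2 hf
  epi_g := (ModuleCat.epi_iff_surjective _).2 hg

lemma exact_map {f : N₁ →ₗ[A] N₂} {g : N₂ →ₗ[A] N₃} (hf : Function.Injective f)
    (hg : Function.Surjective g) (hfg : Function.Exact f g) (i : ℕ) :
    Function.Exact (map J i f) (map J i g) :=
  LocCoh.exact_map_map J (shortExact hf hg hfg) i

variable (J) in
lemma exists_connecting {f : N₁ →ₗ[A] N₂} {g : N₂ →ₗ[A] N₃} (hf : Function.Injective f)
    (hg : Function.Surjective g) (hfg : Function.Exact f g) (i : ℕ) :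
    ∃ δ : H J i N₃ →ₗ[A] H J (i + 1) N₁,
      Function.Exact (map J i g) δ ∧ Function.Exact δ (map J (i + 1) f) :=
  ⟨LocCoh.δ J i (shortExact hf hg hfg), LocCoh.exact_map_δ J (shortExact hf hg hfg) i,
    LocCoh.exact_δ_map J (shortExact hf hg hfg) i⟩

lemma map_lsmul (i : ℕ) (r : A) (x : H J i N) : map J i (LinearMap.lsmul A N r) x = r • x :=
  LocCoh.map_smul_id J i (ModuleCat.of A N) r x

lemma isPowTorsion (i : ℕ) : IsPowTorsion J (H J i N) :=
  LocCoh.exists_pow_smul_eq_zero J i (ModuleCat.of A N)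

variable (J N) in
/-- The inclusion of local cohomology in degree zero. -/
noncomputable def ι : H J 0 N →ₗ[A] N := LocCoh.ι J (ModuleCat.of A N)

lemma ι_injective : Function.Injective (ι J N) := LocCoh.ι_injective J (ModuleCat.of A N)

variable (J N) in
lemma range_ι : LinearMap.range (ι J N) = powTorsion J N :=
  Submodule.ext (LocCoh.mem_range_ι J (ModuleCat.of A N))

lemma ι_map (f : N₁ →ₗ[A] N₂) (x : H J 0 N₁) : ι J N₂ (map J 0 f x) = f (ι J N₁ x) :=
  LocCoh.ι_map J (ModuleCat.ofHom f) x

lemma subsingleton_zero_iff : Subsingleton (H J 0 N) ↔ powTorsion J N = ⊥ := by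
  rw [← range_ι, LinearMap.range_eq_bot]
  refine ⟨fun _ ↦ LinearMap.ext fun x ↦ by rw [Subsingleton.elim x 0, map_zero, map_zero],
    fun h ↦ ⟨fun x y ↦ ι_injective (J := J) (by rw [h]; rfl)⟩⟩

lemma subsingleton_of_injective [Module.Injective A N] (i : ℕ) : Subsingleton (H J (i + 1) N) :=
  have := Module.injective_object_of_injective_module A N
  inferInstanceAs (Subsingleton (LocCoh J (i + 1) (ModuleCat.of A N)))

lemma map_zero_surjective (h : IsPowTorsion J N₁) (f : N₁ →ₗ[A] N₂)
    (hf : Function.Surjective f) : Function.Surjective (map J 0 f) := by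
  intro y
  obtain ⟨x, hx⟩ := hf (ι J N₂ y)
  obtain ⟨z, rfl⟩ : x ∈ LinearMap.range (ι J N₁) := by rw [range_ι]; exact h x
  exact ⟨z, ι_injective (by rw [ι_map, hx])⟩

/-- Dimension shifting along an embedding of T in the torsion part of an injective module, which is
itself injective and has a torsion quotient. In degree 1 the connecting map is zero, because H^0 of
a torsion module is the whole module. -/
lemma subsingleton_of_isPowTorsion [IsNoetherianRing A] (i : ℕ) {T : Type u} [AddCommGroup T]
    [Module A T] (hT : IsPowTorsion J T) : Subsingleton (H J (i + 1) T) := by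
  induction i using Nat.strong_induction_on generalizing T with | _ i ih => ?_
  let T' := ModuleCat.of A T
  let E := Injective.under T'
  have : Module.Injective A E :=
    Module.injective_module_of_injective_object A E (inj := Injective.injective_under T')
  have := injective_powTorsion (J := J) E
  let f : T →ₗ[A] powTorsion J E := (Injective.ι T').hom.codRestrict _ fun x ↦ by
    obtain ⟨t, ht⟩ := hT x
    exact ⟨t, fun r hr ↦ by rw [← map_smul]; exact (congrArg _ (ht r hr)).trans (map_zero _)⟩
  have hf : Function.Injective f := fun x y h ↦
    (ModuleCat.mono_iff_injective (Injective.ι T')).1 inferInstance (congrArg Subtype.val h)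
  have hg := Submodule.mkQ_surjective (LinearMap.range f)
  obtain ⟨δ, h1, h2⟩ := exists_connecting J hf hg f.exact_map_mkQ_range i
  have := subsingleton_of_injective (J := J) (N := powTorsion J E) i
  refine subsingleton_of_forall_eq 0 fun x ↦ ?_
  obtain ⟨y, rfl⟩ := (h2 x).1 (Subsingleton.elim _ _)
  rw [h1]
  cases i with
  | zero => exact map_zero_surjective isPowTorsion_powTorsion _ hg y
  | succ i =>
    have := ih i (by lia) (isPowTorsion_powTorsion.of_surjective _ hg)
    exact ⟨0, Subsingleton.elim _ _⟩

end H

end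

end PseudoSupport

end

/-! ### Artinian modules: a criterion and secondary decomposition -/

section

open IsLocalRing
open scoped Pointwise

namespace PseudoSupport

section Artinian

variable {A : Type*} [CommRing A] {X : Type*} [AddCommGroup X] [Module A X]

/-- If every element of `X` is annihilated by a power of `x` and the annihilator of `x` in `X` is
Artinian, then `X` is Artinian. -/
theorem isArtinian_of_isArtinian_ker_lsmul (x : A) (h : ∀ y : X, ∃ n : ℕ, x ^ n • y = 0)
    [IsArtinian A (LinearMap.ker (LinearMap.lsmul A X x))] : IsArtinian A X := by
  rw [← monotone_stabilizes_iff_artinian]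
  intro f
  let K := LinearMap.ker (LinearMap.lsmul A X x)
  let Y (j : ℕ) : Submodule A X := OrderDual.ofDual (f j)
  have hY {i j : ℕ} (hij : i ≤ j) : Y j ≤ Y i := f.monotone hij
  -- W j n is x^n (Y j ∩ (0 : x^(n+1))), a submodule of the Artinian module (0 : x), decreasing in
  -- both indices. The W j n for all n determine Y j within a larger member of the chain.
  let W (j n : ℕ) : Submodule A K := ((Y j ⊓ LinearMap.ker (LinearMap.lsmul A X (x ^ (n + 1)))).map
    (LinearMap.lsmul A X (x ^ n))).comap K.subtype
  have mem_W {j n : ℕ} {k : K} :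
      k ∈ W j n ↔ ∃ y ∈ Y j, x ^ (n + 1) • y = 0 ∧ x ^ n • y = k := by
    simp [W, and_assoc]
  have hW1 {i j : ℕ} (n : ℕ) (hij : i ≤ j) : W j n ≤ W i n := by
    intro k hk
    obtain ⟨y, hy, h1, h2⟩ := mem_W.1 hk
    exact mem_W.2 ⟨y, hY hij hy, h1, h2⟩
  have hW2 (j : ℕ) : Antitone (W j) := by
    refine antitone_nat_of_succ_le fun n k hk ↦ ?_
    obtain ⟨y, hy, h1, h2⟩ := mem_W.1 hk
    exact mem_W.2 ⟨x • y, (Y j).smul_mem x hy, by rw [← h1, smul_smul, ← pow_succ],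
      by rw [← h2, smul_smul, ← pow_succ]⟩
  obtain ⟨N, hN⟩ := IsArtinian.monotone_stabilizes
    (⟨fun i ↦ OrderDual.toDual (W i i), fun i j hij ↦ (hW1 j hij).trans (hW2 i hij)⟩ :
      ℕ →o (Submodule A K)ᵒᵈ)
  replace hN (m : ℕ) (hm : N ≤ m) : W N N = W m m := hN m hm
  have hst (n : ℕ) := IsArtinian.monotone_stabilizes
    (⟨fun i ↦ OrderDual.toDual (W i n), fun i j hij ↦ hW1 n hij⟩ : ℕ →o (Submodule A K)ᵒᵈ)
  choose J hJ using hst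
  replace hJ (n m : ℕ) (hm : J n ≤ m) : W (J n) n = W m n := hJ n m hm
  -- The diagonal chain controls every n ≥ N; the finitely many n < N are stabilized one at a time.
  let j₀ := max N ((Finset.range N).sup J)
  have key (j n : ℕ) (hj : j₀ ≤ j) : W j₀ n ≤ W j n := by
    by_cases hn : n < N
    · have h1 : J n ≤ j₀ := (Finset.le_sup (f := J) (Finset.mem_range.2 hn)).trans
        (le_max_right _ _)
      rw [← hJ n j₀ h1, ← hJ n j (h1.trans hj)]
    · have h1 : N ≤ j₀ := le_max_left _ _
      calc W j₀ n ≤ W N n := hW1 n h1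
        _ ≤ W N N := hW2 N (by lia)
        _ = W (max j n) (max j n) := hN _ (by lia)
        _ ≤ W j (max j n) := hW1 _ (le_max_left _ _)
        _ ≤ W j n := hW2 j (le_max_right _ _)
  refine ⟨j₀, fun j hj ↦ ?_⟩
  change Y j₀ = Y j
  refine le_antisymm (fun y hy ↦ ?_) (hY hj)
  obtain ⟨n, hn⟩ := h y
  induction n generalizing y with
  | zero =>
    rw [pow_zero, one_smul] at hn
    rw [hn]
    exact zero_mem _
  | succ n ih =>
    have hk : x ^ n • y ∈ K := by
      rw [LinearMap.mem_ker, LinearMap.lsmul_apply, smul_smul, ← pow_succ', hn]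
    obtain ⟨y', hy', -, h2⟩ := mem_W.1 (key j n hj (mem_W.2 ⟨y, hy, hn, rfl⟩ : ⟨_, hk⟩ ∈ W j₀ n))
    have := ih (y - y') (sub_mem hy (hY hj hy')) (by rw [smul_sub, h2, sub_self])
    simpa using add_mem this hy'

/-- A sum-irreducible Artinian module is secondary. -/
lemma exists_smul_eq_or_exists_pow_smul_eq_zero [IsArtinian A X] {C : Submodule A X}
    (hC : SupIrred C) (x : A) :
    (∀ c ∈ C, ∃ c' ∈ C, x • c' = c) ∨ ∃ n : ℕ, ∀ c ∈ C, x ^ n • c = 0 := by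
  obtain ⟨n, hn⟩ := IsArtinian.range_smul_pow_stabilizes C x
  let f := LinearMap.lsmul A X (x ^ (n + 1))
  have hf : C.map f ≤ C := by
    rintro _ ⟨c, hc, rfl⟩
    exact C.smul_mem _ hc
  -- Fitting decomposition of C. The exponent is n + 1 so that, when C = x^(n+1) C, one factor x can
  -- be split off.
  have h : C.map f ⊔ (C ⊓ LinearMap.ker f) = C := by
    refine le_antisymm (sup_le hf inf_le_left) fun c hc ↦ ?_
    have h1 := (hn (n + 1) (by lia)).symm.trans (hn ((n + 1) + (n + 1)) (by lia))
    have h2 : x ^ (n + 1) • (⟨c, hc⟩ : C) ∈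
        LinearMap.range (x ^ (n + 1) • (LinearMap.id : C →ₗ[A] C)) :=
      LinearMap.mem_range.2 ⟨⟨c, hc⟩, rfl⟩
    rw [h1] at h2
    obtain ⟨⟨c', hc'⟩, h3⟩ := LinearMap.mem_range.1 h2
    replace h3 : x ^ (n + 1 + (n + 1)) • c' = x ^ (n + 1) • c := congrArg Subtype.val h3
    have h4 : c = x ^ (n + 1) • c' + (c - x ^ (n + 1) • c') := by abel
    rw [h4]
    refine Submodule.add_mem_sup ⟨c', hc', rfl⟩ ⟨sub_mem hc (C.smul_mem _ hc'), ?_⟩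
    simp [f, smul_sub, smul_smul, ← pow_add, h3]
  rcases hC.2 h with h | h
  · left
    intro c hc
    rw [← h] at hc
    obtain ⟨c', hc', rfl⟩ := hc
    exact ⟨x ^ n • c', C.smul_mem _ hc', by rw [smul_smul, ← pow_succ']; rfl⟩
  · right
    refine ⟨n + 1, fun c hc ↦ ?_⟩
    rw [← h] at hc
    exact hc.2

lemma isPrime_radical_annihilator [IsArtinian A X] {C : Submodule A X} (hC : SupIrred C) :
    C.annihilator.radical.IsPrime := by
  have key (x : A) (hx : x ∉ C.annihilator.radical) : ∀ c ∈ C, ∃ c' ∈ C, x • c' = c := by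
    refine (exists_smul_eq_or_exists_pow_smul_eq_zero hC x).resolve_right ?_
    rintro ⟨n, hn⟩
    exact hx ⟨n, Submodule.mem_annihilator.2 hn⟩
  constructor
  · rw [Ne, Ideal.radical_eq_top, Submodule.annihilator_eq_top_iff]
    exact hC.ne_bot
  · intro x y hxy
    by_contra! h
    obtain ⟨n, hn⟩ := hxy
    have h1' : ∀ c ∈ C, ∃ c' ∈ C, (x * y) • c' = c := fun c hc ↦ by
      obtain ⟨c₁, h1, rfl⟩ := key x h.1 c hc
      obtain ⟨c₂, h2, rfl⟩ := key y h.2 c₁ h1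
      exact ⟨c₂, h2, mul_smul x y c₂⟩
    have h2 (k : ℕ) : ∀ c ∈ C, ∃ c' ∈ C, (x * y) ^ k • c' = c := by
      induction k with
      | zero => exact fun c hc ↦ ⟨c, hc, by simp⟩
      | succ k ih =>
        intro c hc
        obtain ⟨c₁, h1, rfl⟩ := ih c hc
        obtain ⟨c₂, h2, rfl⟩ := h1' c₁ h1
        exact ⟨c₂, h2, by rw [smul_smul, ← pow_succ]⟩
    refine hC.ne_bot (eq_bot_iff.2 fun c hc ↦ ?_)
    obtain ⟨c', hc', rfl⟩ := h2 n c hc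
    exact Submodule.mem_annihilator.1 hn c' hc'

variable [IsLocalRing A] [IsNoetherianRing A]

lemma isArtinianRing_quotient_maximalIdeal_pow (t : ℕ) :
    IsArtinianRing (A ⧸ maximalIdeal A ^ (t + 1)) := by
  apply quotient_artinian_of_mem_minimalPrimes_of_isLocalRing
  refine ⟨⟨inferInstance, Ideal.pow_le_self (by simp)⟩, fun q hq _ ↦ ?_⟩
  exact hq.1.le_of_pow_le hq.2

/-- X is a module over the Artinian ring A/𝔪^(t+1), where the two chain conditions agree
(Hopkins–Levitzki). -/
lemma isNoetherian_iff_isArtinian_of_pow_smul (t : ℕ)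
    (h : ∀ r ∈ maximalIdeal A ^ t, ∀ x : X, r • x = 0) :
    IsNoetherian A X ↔ IsArtinian A X := by
  have h' : Module.IsTorsionBySet A X (maximalIdeal A ^ (t + 1) : Ideal A) :=
    fun x r ↦ h r (Ideal.pow_le_pow_right (by lia) r.2) x
  let _ := h'.module
  have := isArtinianRing_quotient_maximalIdeal_pow (A := A) t
  have h1 := IsSemiprimaryRing.isNoetherian_iff_isArtinian (R := A ⧸ maximalIdeal A ^ (t + 1))
    (M := X)
  rwa [← h'.semilinearMap.isNoetherian_iff_of_bijective Function.bijective_id,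
    ← h'.semilinearMap.isArtinian_iff_of_bijective Function.bijective_id] at h1

/-- If an Artinian module is not finitely generated modulo `x`, then `x` lies in one of finitely
many non-maximal primes. -/
theorem exists_finset_finite_quotSMulTop [IsArtinian A X] :
    ∃ s : Finset (Ideal A), (∀ p ∈ s, p.IsPrime ∧ p ≠ maximalIdeal A) ∧
      ∀ x : A, (∀ p ∈ s, x ∉ p) → Module.Finite A (QuotSMulTop x X) := by
  classical
  obtain ⟨S, hS, hirr⟩ := exists_supIrred_decomposition (⊤ : Submodule A X)
  refine ⟨(S.image fun C ↦ C.annihilator.radical).filter (· ≠ maximalIdeal A), ?_, fun x hx ↦ ?_⟩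
  · intro p hp
    rw [Finset.mem_filter, Finset.mem_image] at hp
    obtain ⟨⟨C, hC, rfl⟩, hne⟩ := hp
    exact ⟨isPrime_radical_annihilator (hirr hC), hne⟩
  -- These components are killed by a power of 𝔪, hence of finite length. On the others x acts
  -- surjectively once it avoids their primes, so X = xX + T.
  let T := (S.filter fun C ↦ C.annihilator.radical = maximalIdeal A).sup id
  have hT : T.FG := by
    refine Submodule.fg_finset_sup _ _ fun C hC ↦ ?_
    rw [Finset.mem_filter] at hC
    obtain ⟨t, ht⟩ := Ideal.exists_pow_le_of_le_radical_of_fg hC.2.ge (IsNoetherian.noetherian _)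
    have := (isNoetherian_iff_isArtinian_of_pow_smul (X := C) t fun r hr c ↦
      Subtype.ext (Submodule.mem_annihilator.1 (ht hr) c c.2)).2 inferInstance
    exact Module.Finite.iff_fg.1 (inferInstanceAs (Module.Finite A C))
  have htop : ⊤ ≤ x • (⊤ : Submodule A X) ⊔ T := by
    rw [← hS]
    refine Finset.sup_le fun C hC ↦ ?_
    by_cases h : C.annihilator.radical = maximalIdeal A
    · exact le_sup_of_le_right (Finset.le_sup (f := id) (Finset.mem_filter.2 ⟨hC, h⟩))
    · refine le_sup_of_le_left fun c hc ↦ ?_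
      have hx' := hx _ (Finset.mem_filter.2 ⟨Finset.mem_image_of_mem _ hC, h⟩)
      obtain ⟨c', -, rfl⟩ :=
        (exists_smul_eq_or_exists_pow_smul_eq_zero (hirr hC) x).resolve_right (by
          rintro ⟨n, hn⟩
          exact hx' ⟨n, Submodule.mem_annihilator.2 hn⟩) c hc
      exact Submodule.smul_mem_pointwise_smul _ _ _ (hS ▸ Submodule.mem_top)
  constructor
  have h : T.map (x • (⊤ : Submodule A X)).mkQ = ⊤ := by
    rw [eq_top_iff, ← Submodule.range_mkQ (x • (⊤ : Submodule A X)), LinearMap.range_eq_map]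
    refine (Submodule.map_mono htop).trans ?_
    rw [Submodule.map_sup, Submodule.mkQ_map_self, bot_sup_eq]
  exact h ▸ hT.map _

end Artinian

end PseudoSupport

end

/-! ### Regular elements and Grothendieck's theorems -/

section

open IsLocalRing
open scoped Pointwise

namespace PseudoSupport

variable {A : Type u} [CommRing A]
  {N : Type u} [AddCommGroup N] [Module A N]

namespace H

/-! ### The long exact sequence of multiplication by a regular element -/

section

variable {J : Ideal A} {x : A}

lemma smul_eq_zero_imp (hx : IsSMulRegular N x) (i : ℕ) [Subsingleton (H J i (QuotSMulTop x N))]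
    (y : H J (i + 1) N) (hy : x • y = 0) : y = 0 := by
  obtain ⟨δ, h1, h2⟩ := exists_connecting J (f := LinearMap.lsmul A N x) hx
    (Submodule.mkQ_surjective _) (LinearMap.exact_lsmul_mkQ_smul_top N x) i
  rw [← map_lsmul] at hy
  obtain ⟨z, rfl⟩ := (h2 y).1 hy
  rw [Subsingleton.elim z 0, map_zero]

/-- Multiplication by x is injective on H^(i+1)(N), yet some power of x kills each element. -/
lemma subsingleton_succ_of_quotSMulTop (hx : IsSMulRegular N x) (hxJ : x ∈ J) (i : ℕ)
    [Subsingleton (H J i (QuotSMulTop x N))] : Subsingleton (H J (i + 1) N) := by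
  refine subsingleton_of_forall_eq 0 fun y ↦ ?_
  obtain ⟨t, ht⟩ := isPowTorsion (J := J) (i + 1) y
  replace ht := ht (x ^ t) (Ideal.pow_mem_pow hxJ t)
  induction t with
  | zero => simpa using ht
  | succ t ih => exact ih (smul_eq_zero_imp hx i _ (by rwa [smul_smul, ← pow_succ']))

lemma smul_surjective (hx : IsSMulRegular N x) (i : ℕ) [Subsingleton (H J i (QuotSMulTop x N))]
    (y : H J i N) : ∃ z, x • z = y := by
  obtain ⟨z, hz⟩ := (exact_map (J := J) (f := LinearMap.lsmul A N x) hx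
    (Submodule.mkQ_surjective _) (LinearMap.exact_lsmul_mkQ_smul_top N x) i y).1
    (Subsingleton.elim _ _)
  exact ⟨z, by rw [← hz, map_lsmul]⟩

lemma nontrivial_succ (hx : IsSMulRegular N x) (i : ℕ) [Subsingleton (H J i N)]
    [Nontrivial (H J i (QuotSMulTop x N))] : Nontrivial (H J (i + 1) N) := by
  obtain ⟨δ, h1, h2⟩ := exists_connecting J (f := LinearMap.lsmul A N x) hx
    (Submodule.mkQ_surjective _) (LinearMap.exact_lsmul_mkQ_smul_top N x) i
  refine Function.Injective.nontrivial (f := δ) ((injective_iff_map_eq_zero δ).2 fun y hy ↦ ?_)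
  obtain ⟨z, rfl⟩ := (h1 y).1 hy
  rw [Subsingleton.elim z 0, map_zero]

/-- Vanishing of H^(i+1)(N) makes H^i(N) → H^i(N/xN) surjective, and this map kills x H^i(N). -/
lemma finite_quotSMulTop (hx : IsSMulRegular N x) (i : ℕ) [Subsingleton (H J (i + 1) N)]
    [Module.Finite A (QuotSMulTop x (H J i N))] :
    Module.Finite A (H J i (QuotSMulTop x N)) := by
  have hf : Function.Injective (LinearMap.lsmul A N x) := hx
  have hg := Submodule.mkQ_surjective (x • (⊤ : Submodule A N))
  have hfg := LinearMap.exact_lsmul_mkQ_smul_top N x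
  obtain ⟨δ, h1, h2⟩ := exists_connecting J hf hg hfg i
  have h3 := exact_map (J := J) hf hg hfg i
  refine Module.Finite.of_surjective ((x • (⊤ : Submodule A (H J i N))).liftQ
    (map J i (x • (⊤ : Submodule A N)).mkQ) ?_) ?_
  · rintro _ ⟨y, -, rfl⟩
    exact (h3 _).2 ⟨y, map_lsmul i x y⟩
  · intro y
    obtain ⟨z, rfl⟩ := (h1 y).1 (Subsingleton.elim _ _)
    exact ⟨Submodule.Quotient.mk z, rfl⟩

lemma isArtinian_succ_of_quotSMulTop (hx : IsSMulRegular N x) (hxJ : x ∈ J) (i : ℕ)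
    [IsArtinian A (H J i (QuotSMulTop x N))] : IsArtinian A (H J (i + 1) N) := by
  obtain ⟨δ, h1, h2⟩ := exists_connecting J (f := LinearMap.lsmul A N x) hx
    (Submodule.mkQ_surjective _) (LinearMap.exact_lsmul_mkQ_smul_top N x) i
  have h3 : LinearMap.ker (LinearMap.lsmul A (H J (i + 1) N) x) = LinearMap.range δ := by
    ext y
    rw [LinearMap.mem_ker, LinearMap.lsmul_apply, ← map_lsmul]
    exact h2 y
  have : IsArtinian A (LinearMap.ker (LinearMap.lsmul A (H J (i + 1) N) x)) := by
    rw [h3]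
    exact isArtinian_of_surjective _ δ.rangeRestrict δ.surjective_rangeRestrict
  refine isArtinian_of_isArtinian_ker_lsmul x fun y ↦ ?_
  obtain ⟨t, ht⟩ := isPowTorsion (J := J) (i + 1) y
  exact ⟨t, ht _ (Ideal.pow_mem_pow hxJ t)⟩

end

section

variable [IsNoetherianRing A]

lemma map_mkQ_powTorsion_injective (J : Ideal A) (i : ℕ) :
    Function.Injective (map J (i + 1) (powTorsion J N).mkQ) := by
  have := subsingleton_of_isPowTorsion i (isPowTorsion_powTorsion : IsPowTorsion J (powTorsion J N))
  have h := exact_map (J := J) (powTorsion J N).injective_subtype (powTorsion J N).mkQ_surjective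
    (LinearMap.exact_subtype_mkQ _) (i + 1)
  refine (injective_iff_map_eq_zero _).2 fun y hy ↦ ?_
  obtain ⟨z, rfl⟩ := (h y).1 hy
  rw [Subsingleton.elim z 0, map_zero]

lemma map_mkQ_powTorsion_surjective (J : Ideal A) (i : ℕ) :
    Function.Surjective (map J (i + 1) (powTorsion J N).mkQ) := by
  have := subsingleton_of_isPowTorsion (i + 1)
    (isPowTorsion_powTorsion : IsPowTorsion J (powTorsion J N))
  obtain ⟨δ, h1, -⟩ := exists_connecting J (powTorsion J N).injective_subtype
    (powTorsion J N).mkQ_surjective (LinearMap.exact_subtype_mkQ _) (i + 1)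
  exact fun y ↦ (h1 y).1 (Subsingleton.elim _ _)

end

end H

variable [IsLocalRing A]

lemma support_subset_of_isPowTorsion [Module.Finite A N] (h : IsPowTorsion (maximalIdeal A) N) :
    Module.support A N ⊆ {closedPoint A} := by
  obtain ⟨t, ht⟩ := h.exists_pow
  intro p hp
  rw [Module.support_eq_zeroLocus, PrimeSpectrum.mem_zeroLocus] at hp
  have h1 : maximalIdeal A ^ t ≤ p.asIdeal := fun r hr ↦ hp (Module.mem_annihilator.2 (ht r hr))
  refine PrimeSpectrum.ext ?_
  exact ((maximalIdeal.isMaximal A).eq_of_le p.2.ne_top (p.2.le_of_pow_le h1)).symm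

lemma supportDim_le_zero_of_support_subset (h : Module.support A N ⊆ {closedPoint A}) :
    Module.supportDim A N ≤ 0 := by
  have : Subsingleton (Module.support A N) :=
    ⟨fun x y ↦ Subtype.ext ((h x.2).trans (h y.2).symm)⟩
  exact Order.krullDim_nonpos_iff_forall_isMax.2 fun x y _ ↦ (Subsingleton.elim y x).le

variable [IsNoetherianRing A]

/-- A finitely generated module without `𝔪`-torsion has a regular element in `𝔪` which avoids
finitely many given non-maximal primes. -/
lemma exists_isSMulRegular_avoiding [Module.Finite A N] (h : powTorsion (maximalIdeal A) N = ⊥)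
    (s : Finset (Ideal A)) (hs : ∀ p ∈ s, p.IsPrime ∧ p ≠ maximalIdeal A) :
    ∃ x ∈ maximalIdeal A, IsSMulRegular N x ∧ ∀ p ∈ s, x ∉ p := by
  classical
  let S := s ∪ (associatedPrimes.finite A N).toFinset
  have hS : ∀ p ∈ S, p.IsPrime ∧ p ≠ maximalIdeal A := by
    intro p hp
    rcases Finset.mem_union.1 hp with hp | hp
    · exact hs p hp
    · rw [Set.Finite.mem_toFinset] at hp
      refine ⟨hp.isPrime, ?_⟩
      rintro rfl
      obtain ⟨-, y, hy⟩ := isAssociatedPrime_iff.1 hp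
      have h1 : y ∈ powTorsion (maximalIdeal A) N := by
        refine ⟨1, fun r hr ↦ ?_⟩
        rw [pow_one, hy] at hr
        simpa [Submodule.mem_colon_singleton] using hr
      rw [h, Submodule.mem_bot] at h1
      subst h1
      exact (maximalIdeal.isMaximal A).ne_top (hy.trans (by simp))
  have hnot : ¬ ((maximalIdeal A : Set A) ⊆ ⋃ p ∈ (S : Set (Ideal A)), p) := by
    rw [Ideal.subset_union_prime ⊥ ⊥ fun p hp _ _ ↦ (hS p hp).1]
    rintro ⟨p, hp, hle⟩
    exact (hS p hp).2 ((maximalIdeal.isMaximal A).eq_of_le (hS p hp).1.ne_top hle).symm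
  obtain ⟨x, hx, hx'⟩ := Set.not_subset.1 hnot
  simp only [Set.mem_iUnion, not_exists] at hx'
  refine ⟨x, hx, ?_, fun p hp ↦ hx' p (Finset.mem_union_left _ hp)⟩
  by_contra hreg
  have h1 : x ∈ ⋃ p ∈ associatedPrimes A N, (p : Set A) := by
    rw [biUnion_associatedPrimes_eq_compl_regular]
    exact hreg
  simp only [Set.mem_iUnion] at h1
  obtain ⟨p, hp, hxp⟩ := h1
  exact hx' p (Finset.mem_union_right _ ((Set.Finite.mem_toFinset _).2 hp)) hxp

lemma isPowTorsion_of_supportDim_le_zero [Module.Finite A N] (h : Module.supportDim A N ≤ 0) :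
    IsPowTorsion (maximalIdeal A) N := by
  cases subsingleton_or_nontrivial N with
  | inl _ => exact fun x ↦ ⟨0, fun r _ ↦ Subsingleton.elim _ _⟩
  | inr _ =>
    have h0 : Module.supportDim A N = 0 := by
      have : Nonempty (Module.support A N) := Module.nonempty_support_of_nontrivial.to_subtype
      exact le_antisymm h Order.krullDim_nonneg
    have h1 := support_of_supportDim_eq_zero A N h0
    rw [Module.support_eq_zeroLocus] at h1
    have h2 : maximalIdeal A ≤ (Module.annihilator A N).radical := by
      rw [← PrimeSpectrum.vanishingIdeal_zeroLocus_eq_radical, h1,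
        PrimeSpectrum.vanishingIdeal_zeroLocus_eq_radical]
      exact Ideal.le_radical
    obtain ⟨t, ht⟩ := Ideal.exists_pow_le_of_le_radical_of_fg h2 (IsNoetherian.noetherian _)
    exact fun x ↦ ⟨t, fun r hr ↦ Module.mem_annihilator.1 (ht hr) x⟩

/-- Removing torsion can affect the support only at the closed point, which stays as long as the
quotient is nonzero; a zero quotient would force dimension at most 0. -/
lemma supportDim_quotient_powTorsion [Module.Finite A N] (h : ¬ Module.supportDim A N ≤ 0) :
    Module.supportDim A (N ⧸ powTorsion (maximalIdeal A) N) = Module.supportDim A N := by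
  let T := powTorsion (maximalIdeal A) N
  have h1 := Module.support_of_exact (LinearMap.exact_subtype_mkQ T) T.injective_subtype
    T.mkQ_surjective
  have h2 := support_subset_of_isPowTorsion (isPowTorsion_powTorsion : IsPowTorsion _ T)
  cases subsingleton_or_nontrivial (N ⧸ T) with
  | inl _ =>
    rw [Module.support_eq_empty (M := N ⧸ T), Set.union_empty] at h1
    exact absurd (supportDim_le_zero_of_support_subset (h1 ▸ h2)) h
  | inr _ =>
    have h3 : Module.support A N = Module.support A (N ⧸ T) := by
      rw [h1, Set.union_eq_right]
      exact h2.trans (Set.singleton_subset_iff.2 (closedPoint_mem_support A (N ⧸ T)))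
    rw [Module.supportDim, Module.supportDim, h3]

namespace H

/-- H^0 is finitely generated and killed by a power of 𝔪. In higher degrees, modulo torsion, the
annihilator of a regular x is a quotient of H^i of N/xN, and `isArtinian_of_isArtinian_ker_lsmul`
applies. -/
theorem isArtinian [Module.Finite A N] (i : ℕ) : IsArtinian A (H (maximalIdeal A) i N) := by
  induction i generalizing N with
  | zero =>
    have h1 := isPowTorsion (J := maximalIdeal A) (N := N) 0
    have : IsNoetherian A (H (maximalIdeal A) 0 N) := isNoetherian_of_injective _ ι_injective
    obtain ⟨t, ht⟩ := h1.exists_pow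
    exact (isNoetherian_iff_isArtinian_of_pow_smul t ht).1 this
  | succ i ih =>
    obtain ⟨x, hxm, hx, -⟩ := exists_isSMulRegular_avoiding
      (powTorsion_quotient_eq_bot (J := maximalIdeal A) (N := N)) ∅ (by simp)
    have := ih (N := QuotSMulTop x (N ⧸ powTorsion (maximalIdeal A) N))
    have := isArtinian_succ_of_quotSMulTop hx hxm i
    exact isArtinian_of_injective _ (map_mkQ_powTorsion_injective (maximalIdeal A) i)

/-- Grothendieck's vanishing theorem. -/
theorem subsingleton_of_supportDim_lt [Module.Finite A N] {n : ℕ}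
    (hn : Module.supportDim A N ≤ n) {i : ℕ} (hi : n < i) :
    Subsingleton (H (maximalIdeal A) i N) := by
  obtain ⟨i, rfl⟩ : ∃ j, i = j + 1 := ⟨i - 1, by lia⟩
  induction n generalizing N i with
  | zero => exact subsingleton_of_isPowTorsion i (isPowTorsion_of_supportDim_le_zero hn)
  | succ n ih =>
    obtain ⟨x, hxm, hx, -⟩ := exists_isSMulRegular_avoiding
      (powTorsion_quotient_eq_bot (J := maximalIdeal A) (N := N)) ∅ (by simp)
    have h1 : Module.supportDim A (QuotSMulTop x (N ⧸ powTorsion (maximalIdeal A) N)) ≤ n := by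
      rw [← ENat.WithBot.add_le_add_one_right_iff, Module.supportDim_quotSMulTop_succ_eq_supportDim hx hxm]
      exact (Module.supportDim_le_of_surjective _ (Submodule.mkQ_surjective _)).trans
        (by exact_mod_cast hn)
    obtain ⟨i, rfl⟩ : ∃ j, i = j + 1 := ⟨i - 1, by lia⟩
    have := ih h1 i (by lia)
    have := subsingleton_succ_of_quotSMulTop hx hxm (i + 1)
    exact (map_mkQ_powTorsion_injective (maximalIdeal A) (i + 1)).subsingleton

/-- Modulo torsion, a regular x in 𝔪 lowers the dimension, so x acts surjectively on the top
cohomology; Nakayama then kills it. -/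
lemma subsingleton_of_finite [Module.Finite A N] {n : ℕ} (hn : Module.supportDim A N = (n + 1 : ℕ))
    [Module.Finite A (H (maximalIdeal A) (n + 1) N)] :
    Subsingleton (H (maximalIdeal A) (n + 1) N) := by
  let N' := N ⧸ powTorsion (maximalIdeal A) N
  obtain ⟨x, hxm, hx, -⟩ := exists_isSMulRegular_avoiding
    (powTorsion_quotient_eq_bot (J := maximalIdeal A) (N := N)) ∅ (by simp)
  have h1 : Module.supportDim A (QuotSMulTop x N') ≤ n := by
    rw [← ENat.WithBot.add_le_add_one_right_iff, Module.supportDim_quotSMulTop_succ_eq_supportDim hx hxm]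
    exact (Module.supportDim_le_of_surjective _ (Submodule.mkQ_surjective _)).trans
      (by exact_mod_cast hn.le)
  have := subsingleton_of_supportDim_lt h1 (Nat.lt_succ_self n)
  have := Module.Finite.of_surjective _ (map_mkQ_powTorsion_surjective (N := N) (maximalIdeal A) n)
  have h2 : Subsingleton (H (maximalIdeal A) (n + 1) N') := by
    rw [← Submodule.subsingleton_iff A, ← subsingleton_iff_bot_eq_top, eq_comm]
    refine Submodule.eq_bot_of_le_smul_of_le_jacobson_bot (maximalIdeal A) _ Module.Finite.fg_top
      (fun y _ ↦ ?_) (maximalIdeal_le_jacobson _)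
    obtain ⟨z, rfl⟩ := smul_surjective hx (n + 1) y
    exact Submodule.smul_mem_smul hxm Submodule.mem_top
  exact (map_mkQ_powTorsion_injective (maximalIdeal A) n).subsingleton

/-- Grothendieck's non-vanishing theorem. -/
theorem nontrivial_of_supportDim_eq [Module.Finite A N] {n : ℕ} (hn : Module.supportDim A N = n) :
    Nontrivial (H (maximalIdeal A) n N) := by
  induction n generalizing N with
  | zero =>
    have h1 := isPowTorsion_of_supportDim_le_zero hn.le
    have : Nontrivial N := by
      rw [← Module.supportDim_ne_bot_iff_nontrivial A, hn]
      exact WithBot.coe_ne_bot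
    rw [← not_subsingleton_iff_nontrivial, subsingleton_zero_iff]
    intro h2
    obtain ⟨x, hx⟩ := exists_ne (0 : N)
    exact hx ((Submodule.mem_bot A).1 (h2 ▸ h1 x))
  | succ n ih =>
    by_contra hcon
    rw [not_nontrivial_iff_subsingleton] at hcon
    let N' := N ⧸ powTorsion (maximalIdeal A) N
    have hbot : powTorsion (maximalIdeal A) N' = ⊥ := powTorsion_quotient_eq_bot
    have hN' : Module.supportDim A N' = (n + 1 : ℕ) := by
      rw [← hn]
      refine supportDim_quotient_powTorsion ?_
      rw [hn]
      norm_cast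
      simp
    have := (map_mkQ_powTorsion_surjective (N := N) (maximalIdeal A) n).subsingleton
    have := isArtinian (A := A) (N := N') n
    -- Choosing x outside these primes makes H^n(N')/x finitely generated, and it maps onto
    -- H^n(N'/xN') because H^(n+1)(N') = 0.
    obtain ⟨s, hs, hfin⟩ := exists_finset_finite_quotSMulTop (A := A)
      (X := H (maximalIdeal A) n N')
    obtain ⟨x, hxm, hx, hxs⟩ := exists_isSMulRegular_avoiding hbot s hs
    have := hfin x hxs
    have hf := finite_quotSMulTop (J := maximalIdeal A) hx n
    have hdim : Module.supportDim A (QuotSMulTop x N') = n := by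
      rw [← ENat.WithBot.add_one_cancel, Module.supportDim_quotSMulTop_succ_eq_supportDim hx hxm, hN']
      norm_cast
    have hnt := ih hdim
    cases n with
    | zero =>
      have : Subsingleton (H (maximalIdeal A) 0 N') := subsingleton_zero_iff.2 hbot
      have := nontrivial_succ (J := maximalIdeal A) hx 0
      exact not_subsingleton (H (maximalIdeal A) (0 + 1) N') ‹_›
    | succ n => exact not_subsingleton _ (subsingleton_of_finite hdim)

end H

end PseudoSupport

end

/-! ### Depth, and dimension under localization -/

section

open IsLocalRing

namespace PseudoSupport

section

variable {A : Type u} [CommRing A] [IsLocalRing A]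
  {N : Type u} [AddCommGroup N] [Module A N]

open RingTheory.Sequence

namespace H

lemma subsingleton_of_isRegular {rs : List A} (hrs : ∀ r ∈ rs, r ∈ maximalIdeal A)
    (h : IsRegular N rs) {i : ℕ} (hi : i < rs.length) : Subsingleton (H (maximalIdeal A) i N) := by
  induction rs generalizing N i with
  | nil => simp at hi
  | cons x rs ih =>
    rw [isRegular_cons_iff] at h
    have hx : x ∈ maximalIdeal A := hrs x (by simp)
    cases i with
    | zero =>
      rw [subsingleton_zero_iff, eq_bot_iff]
      rintro y ⟨t, ht⟩
      exact (h.1.pow t) (by simpa using ht _ (Ideal.pow_mem_pow hx t))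
    | succ i =>
      have := ih (fun r hr ↦ hrs r (by simp [hr])) h.2 (i := i) (by simpa using hi)
      exact subsingleton_succ_of_quotSMulTop h.1 hx i

variable [IsNoetherianRing A]

/-- If H^0 vanished, the empty sequence could be extended by a regular element. Otherwise divide by
the first element x: H^i(N) = 0 for i = length − 1, so H^i(N/xN) embeds in H^(i+1)(N). -/
lemma nontrivial_of_isRegular_maximal [Module.Finite A N] {rs : List A}
    (hrs : ∀ r ∈ rs, r ∈ maximalIdeal A) (h : IsRegular N rs)
    (hmax : ∀ y ∈ maximalIdeal A, ¬ IsRegular N (rs ++ [y])) :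
    Nontrivial (H (maximalIdeal A) rs.length N) := by
  induction rs generalizing N with
  | nil =>
    by_contra hcon
    rw [not_nontrivial_iff_subsingleton, List.length_nil, subsingleton_zero_iff] at hcon
    obtain ⟨x, hxm, hx, -⟩ := exists_isSMulRegular_avoiding hcon ∅ (by simp)
    have : Nontrivial N := by
      by_contra hN
      rw [not_nontrivial_iff_subsingleton] at hN
      exact h.top_ne_smul (Subsingleton.elim _ _)
    refine hmax x hxm ((isRegular_cons_iff _ _ _).2 ⟨hx, ?_⟩)
    have : Nontrivial (QuotSMulTop x N) := by
      rw [Submodule.Quotient.nontrivial_iff]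
      exact (Submodule.top_ne_pointwise_smul_of_mem_jacobson_annihilator
        (maximalIdeal_le_jacobson _ hxm)).symm
    exact IsRegular.nil A _
  | cons x rs ih =>
    have h' := (isRegular_cons_iff _ _ _).1 h
    have := subsingleton_of_isRegular hrs h (i := rs.length) (by simp)
    have := ih (fun r hr ↦ hrs r (by simp [hr])) h'.2
      fun y hy hy' ↦ hmax y hy ((isRegular_cons_iff _ _ _).2 ⟨h'.1, hy'⟩)
    exact nontrivial_succ h'.1 rs.length

end H

variable [IsNoetherianRing A]

variable (A N) in
/-- The depth is the least degree in which the local cohomology does not vanish. -/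
theorem exists_depth_eq [Module.Finite A N] [Nontrivial N] {n : ℕ}
    (hn : Module.supportDim A N = n) :
    ∃ k : ℕ, depth A N = k ∧ k ≤ n ∧ Nontrivial (H (maximalIdeal A) k N) ∧
      ∀ i < k, Subsingleton (H (maximalIdeal A) i N) := by
  let P (k : ℕ) : Prop := ∃ rs : List A, rs.length = k ∧ (∀ r ∈ rs, r ∈ maximalIdeal A) ∧
    IsRegular N rs
  -- A regular sequence longer than dim N would annihilate the nonzero top cohomology. Hence a
  -- longest regular sequence exists.
  have hP (k : ℕ) (hk : P k) : k ≤ n := by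
    obtain ⟨rs, rfl, hrs, h⟩ := hk
    by_contra! hlt
    have := H.nontrivial_of_supportDim_eq hn
    exact not_subsingleton _ (H.subsingleton_of_isRegular hrs h hlt)
  classical
  have h0 : P 0 := ⟨[], rfl, by simp, IsRegular.nil A N⟩
  obtain ⟨rs, hlen, hrs, h⟩ := Nat.findGreatest_spec (Nat.zero_le n) h0
  have hle (k : ℕ) (hk : P k) : k ≤ rs.length := by
    rw [hlen]
    exact Nat.le_findGreatest (hP k hk) hk
  refine ⟨rs.length, le_antisymm ?_ ?_, hP _ ⟨rs, rfl, hrs, h⟩, ?_, fun i hi ↦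
    H.subsingleton_of_isRegular hrs h hi⟩
  · exact iSup_le fun rs' ↦ iSup_le fun h1 ↦ iSup_le fun h2 ↦
      Nat.cast_le.2 (hle _ ⟨rs', rfl, h1, h2⟩)
  · exact le_iSup_of_le rs (le_iSup_of_le hrs (le_iSup_of_le h le_rfl))
  · refine H.nontrivial_of_isRegular_maximal hrs h fun y hy hy' ↦ ?_
    have := hle (rs.length + 1) ⟨rs ++ [y], by simp, by
      intro r hr
      rcases List.mem_append.1 hr with hr | hr
      · exact hrs r hr
      · rwa [List.mem_singleton.1 hr], hy'⟩
    lia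

lemma exists_supportDim_eq [Module.Finite A N] [Nontrivial N] :
    ∃ n : ℕ, Module.supportDim A N = n := by
  have h1 : Module.supportDim A N < ⊤ :=
    (Module.supportDim_le_ringKrullDim A N).trans_lt ringKrullDim_lt_top
  have h2 := Module.supportDim_ne_bot_of_nontrivial A N
  generalize Module.supportDim A N = d at h1 h2
  cases d with
  | bot => exact absurd rfl h2
  | coe d =>
    cases d with
    | top => exact absurd h1 (lt_irrefl _)
    | coe d => exact ⟨d, rfl⟩

end

/-- In the poset Supp M, the height of `p` bounds dim M_p and its coheight bounds dim R/p, since the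
support is closed under specialization. -/
lemma supportDim_localizedModule_add_le (R : Type*) [CommRing R] (M : Type*) [AddCommGroup M]
    [Module R M] [Module.Finite R M] (p : PrimeSpectrum R) (hp : p ∈ Module.support R M) :
    Module.supportDim (Localization.AtPrime p.asIdeal) (LocalizedModule p.asIdeal.primeCompl M) +
      ringKrullDim (R ⧸ p.asIdeal) ≤ Module.supportDim R M := by
  let P : Module.support R M := ⟨p, hp⟩
  have h1 : Module.supportDim (Localization.AtPrime p.asIdeal)
      (LocalizedModule p.asIdeal.primeCompl M) ≤ Order.height P := by
    rw [Order.height_eq_krullDim_Iic]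
    let f := algebraMap R (Localization.AtPrime p.asIdeal)
    refine Order.krullDim_le_of_strictMono (fun q ↦ ⟨⟨PrimeSpectrum.comap f q.1, ?_⟩, ?_⟩) ?_
    · have hq := q.2
      rw [Module.mem_support_iff_of_finite] at hq ⊢
      intro r hr
      refine hq (Module.mem_annihilator.2 fun x ↦ ?_)
      induction x using LocalizedModule.induction_on with | _ m s => ?_
      rw [algebraMap_smul, LocalizedModule.smul'_mk, Module.mem_annihilator.1 hr,
        LocalizedModule.zero_mk]
    · change (PrimeSpectrum.comap f q.1).asIdeal ≤ p.asIdeal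
      have hd := ((IsLocalization.isPrime_iff_isPrime_disjoint p.asIdeal.primeCompl
        (Localization.AtPrime p.asIdeal) q.1.asIdeal).1 q.1.isPrime).2
      intro x hx
      by_contra hxp
      exact Set.disjoint_left.1 hd hxp hx
    · exact Monotone.strictMono_of_injective (fun q q' h x hx ↦ h hx) fun q q' h ↦
        Subtype.ext (PrimeSpectrum.localization_comap_injective _ p.asIdeal.primeCompl
          (congrArg (fun a ↦ a.1.1) h))
  have h2 : ringKrullDim (R ⧸ p.asIdeal) ≤ Order.coheight P := by
    rw [Order.coheight_eq_krullDim_Ici, ringKrullDim_quotient]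
    exact Order.krullDim_le_of_strictMono
      (fun q ↦ ⟨⟨q.1, Module.mem_support_mono (p := p) q.2 hp⟩, q.2⟩) fun _ _ h ↦ h
  refine (add_le_add h1 h2).trans ?_
  have : Nonempty (Module.support R M) := ⟨P⟩
  rw [Module.supportDim, Order.krullDim_eq_iSup_height_add_coheight_of_nonempty]
  rw [← WithBot.coe_add]
  exact WithBot.coe_le_coe.2 (le_iSup (fun a : Module.support R M ↦ Order.height a + Order.coheight a) P)

end PseudoSupport

end

/-! ### Pseudo supports and the theorem -/

section

open IsLocalRing

namespace PseudoSupport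

section

variable {R : Type u} [CommRing R] {M : Type u} [AddCommGroup M] [Module R M]

lemma mem_psupp_iff {p : PrimeSpectrum R} {c : ℕ} (hc : ringKrullDim (R ⧸ p.asIdeal) = c)
    {i : ℕ} : p ∈ Psupp R M i ↔ ∃ j : ℕ, j + c = i ∧
      Nontrivial (H (maximalIdeal (Localization.AtPrime p.asIdeal)) j (Loc R M p)) := by
  simp only [Psupp, Set.mem_ofPred_eq, hc, isZero_localCohomology_obj_iff_subsingleton,
    not_subsingleton_iff_nontrivial]
  norm_cast

variable [IsLocalRing R] [IsNoetherianRing R]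

lemma exists_ringKrullDim_quotient_eq (p : PrimeSpectrum R) :
    ∃ c : ℕ, ringKrullDim (R ⧸ p.asIdeal) = c := by
  rw [← Module.supportDim_quotient_eq_ringKrullDim]
  exact exists_supportDim_eq

variable [Module.Finite R M]

lemma mem_support_of_mem_psupp {p : PrimeSpectrum R} {i : ℕ} (hp : p ∈ Psupp R M i) :
    p ∈ Module.support R M := by
  obtain ⟨c, hc⟩ := exists_ringKrullDim_quotient_eq p
  obtain ⟨j, -, hj⟩ := (mem_psupp_iff hc).1 hp
  rw [Module.mem_support_iff]
  by_contra hN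
  rw [not_nontrivial_iff_subsingleton] at hN
  refine not_subsingleton (H (maximalIdeal (Localization.AtPrime p.asIdeal)) j (Loc R M p)) ?_
  cases j with
  | zero => exact H.subsingleton_zero_iff.2 (Subsingleton.elim _ _)
  | succ j =>
    -- The zero module has dimension ⊥, so 0 is a valid bound.
    refine H.subsingleton_of_supportDim_lt (n := 0) ?_ j.succ_pos
    rw [Module.supportDim_eq_bot_of_subsingleton]
    exact bot_le

/-- Up to the shift by `dim R/𝔭`, the depth and the dimension of `M_𝔭` are the ends of the set of
degrees `i` such that `𝔭` lies in the `i`-th pseudo support. -/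
theorem exists_psupp_bounds {p : PrimeSpectrum R} (hp : p ∈ Module.support R M) :
    ∃ k t c : ℕ, ringKrullDim (R ⧸ p.asIdeal) = c ∧
      depth (Localization.AtPrime p.asIdeal) (Loc R M p) = k ∧
      Module.supportDim (Localization.AtPrime p.asIdeal) (Loc R M p) = t ∧
      k ≤ t ∧ ((t + c : ℕ) : WithBot ℕ∞) ≤ Module.supportDim R M ∧
      p ∈ Psupp R M (k + c) ∧ p ∈ Psupp R M (t + c) ∧
      ∀ i, p ∈ Psupp R M i → k + c ≤ i ∧ i ≤ t + c := by
  obtain ⟨c, hc⟩ := exists_ringKrullDim_quotient_eq p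
  have : Nontrivial (Loc R M p) := Module.mem_support_iff.1 hp
  obtain ⟨t, ht⟩ := exists_supportDim_eq (A := Localization.AtPrime p.asIdeal) (N := Loc R M p)
  obtain ⟨k, hk, hkt, hne, hlt⟩ := exists_depth_eq _ _ ht
  refine ⟨k, t, c, hc, hk, ht, hkt, ?_, (mem_psupp_iff hc).2 ⟨k, rfl, hne⟩,
    (mem_psupp_iff hc).2 ⟨t, rfl, H.nontrivial_of_supportDim_eq ht⟩, fun i hi ↦ ?_⟩
  · have := supportDim_localizedModule_add_le R M p hp
    rw [ht, hc] at this
    exact_mod_cast this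
  · obtain ⟨j, rfl, hj⟩ := (mem_psupp_iff hc).1 hi
    constructor <;> by_contra! h
    · exact not_subsingleton _ (hlt j (by lia))
    · exact not_subsingleton _ (H.subsingleton_of_supportDim_lt ht.le (i := j) (by lia))

end

end PseudoSupport

end

open PseudoSupport in
theorem theorem3p1 (R : Type u) [CommRing R] [IsLocalRing R] [IsNoetherianRing R]
    (M : Type u) [AddCommGroup M] [Module R M] [Module.Finite R M]
    (d : WithBot ℕ∞) (hd : Module.supportDim R M = d) :
    -- (i)
    (∀ p ∈ Module.support R M,
      (∃ i : ℕ, (i : WithBot ℕ∞) ≤ d ∧ p ∈ Psupp R M i) ∧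
      ∃ k t : ℕ,
        IsLeast {i : ℕ | (i : WithBot ℕ∞) ≤ d ∧ p ∈ Psupp R M i} k ∧
        IsGreatest {i : ℕ | (i : WithBot ℕ∞) ≤ d ∧ p ∈ Psupp R M i} t ∧
        (depth (Localization.AtPrime p.asIdeal) (Loc R M p) : WithBot ℕ∞)
          + ringKrullDim (R ⧸ p.asIdeal) = k ∧
        Module.supportDim (Localization.AtPrime p.asIdeal) (Loc R M p)
          + ringKrullDim (R ⧸ p.asIdeal) = t) ∧
    -- (ii)
    nCM R M =
      {p | ∃ i j : ℕ, i < j ∧ (j : WithBot ℕ∞) ≤ d ∧ p ∈ Psupp R M i ∩ Psupp R M j} ∧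
    -- (iii)
    (∀ s : ℤ, {p | ∃ i : ℕ, (i : ℤ) ≤ s ∧ p ∈ Psupp R M i} =
      {p | p ∈ Module.support R M ∧ ∃ n : ℕ, (n : ℤ) ≤ s ∧
        (depth (Localization.AtPrime p.asIdeal) (Loc R M p) : WithBot ℕ∞)
          + ringKrullDim (R ⧸ p.asIdeal) = n}) ∧
    -- (iv)
    (∀ p ∈ Module.support R M, (∀ i : ℕ, (i : WithBot ℕ∞) < d → p ∉ Psupp R M i) →
      IsCohenMacaulay (Localization.AtPrime p.asIdeal) (Loc R M p) ∧
      Module.supportDim (Localization.AtPrime p.asIdeal) (Loc R M p)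
        + ringKrullDim (R ⧸ p.asIdeal) = d) := by
  subst hd
  refine ⟨fun p hp ↦ ?_, Set.ext fun p ↦ ⟨fun hp ↦ ?_, ?_⟩, fun s ↦ Set.ext fun p ↦ ⟨?_, ?_⟩,
    fun p hp hi ↦ ?_⟩
  · obtain ⟨k, t, c, hc, hk, ht, hkt, htd, hkm, htm, hb⟩ := exists_psupp_bounds hp
    have hkd : ((k + c : ℕ) : WithBot ℕ∞) ≤ Module.supportDim R M :=
      le_trans (Nat.cast_le.2 (by lia)) htd
    refine ⟨⟨_, htd, htm⟩, k + c, t + c, ⟨⟨hkd, hkm⟩, fun i hi ↦ (hb i hi.2).1⟩,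
      ⟨⟨htd, htm⟩, fun i hi ↦ (hb i hi.2).2⟩, ?_, ?_⟩
    · rw [hk, hc]
      norm_cast
    · rw [ht, hc]
      norm_cast
  · obtain ⟨hN, hne⟩ := not_or.1 hp
    have hp' : p ∈ Module.support R M :=
      Module.mem_support_iff.2 (not_subsingleton_iff_nontrivial.1 hN)
    obtain ⟨k, t, c, hc, hk, ht, hkt, htd, hkm, htm, hb⟩ := exists_psupp_bounds hp'
    refine ⟨k + c, t + c, ?_, htd, hkm, htm⟩
    have : k ≠ t := by
      rintro rfl
      exact hne (by rw [hk, ht]; norm_cast)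
    lia
  · rintro ⟨i, j, hij, -, hi, hj⟩
    obtain ⟨k, t, c, hc, hk, ht, hkt, htd, hkm, htm, hb⟩ :=
      exists_psupp_bounds (mem_support_of_mem_psupp hi)
    have := hb i hi
    have := hb j hj
    have := Module.mem_support_iff.1 (mem_support_of_mem_psupp hi)
    rintro (h | h)
    · exact not_subsingleton _ h
    · rw [hk, ht] at h
      norm_cast at h
      lia
  · rintro ⟨i, his, hi⟩
    obtain ⟨k, t, c, hc, hk, ht, hkt, htd, hkm, htm, hb⟩ :=
      exists_psupp_bounds (mem_support_of_mem_psupp hi)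
    have := hb i hi
    refine ⟨mem_support_of_mem_psupp hi, k + c, by lia, ?_⟩
    rw [hk, hc]
    norm_cast
  · rintro ⟨hp, n, hns, hn⟩
    obtain ⟨k, t, c, hc, hk, ht, hkt, htd, hkm, htm, hb⟩ := exists_psupp_bounds hp
    rw [hk, hc] at hn
    norm_cast at hn
    exact ⟨k + c, by lia, hkm⟩
  · obtain ⟨k, t, c, hc, hk, ht, hkt, htd, hkm, htm, hb⟩ := exists_psupp_bounds hp
    -- `p` lies in the pseudo supports of degrees k + c ≤ t + c ≤ d, and no degree below d is
    -- allowed, so both equal d.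
    have heq : ((t + c : ℕ) : WithBot ℕ∞) = Module.supportDim R M :=
      htd.eq_or_lt.resolve_right fun h ↦ hi _ h htm
    have hkt' : k = t := by
      by_contra hne
      exact hi (k + c) (lt_of_lt_of_le (Nat.cast_lt.2 (by lia)) htd) hkm
    refine ⟨Or.inr ?_, ?_⟩
    · rw [hk, ht, hkt']
      norm_cast
    · rw [ht, hc, ← heq]
      norm_cast
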